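/- Let $H^2\subset L^2=L^2(\mathbb T,\tfrac{d\theta}{2\pi})$ be the Hardy space of the unit circle (the functions in $L^2$ whose Fourier coefficients of negative index vanish), let $P:L^2\to H^2$ be the orthogonal projection, and let $S$ be the shift $Sf=zf$ on $H^2$, where $z=e^{i\theta}$. A Sarason-Toeplitz operator is a closed densely defined linear operator $T$ on $H^2$ with domain $D(T)$ such that (1) $D(T)$ is $S$-invariant, (2) $S^*TSf=Tf$ for all $f\in D(T)$, and (3) $S^*f\in D(T)$ whenever $f\in D(T)$ and $f(0)=0$. For a function $\phi$ on $\mathbb T$ let $T_\phi=PM_\phi$ be the multiplication type Toeplitz operator on $H^2$ with domain $D(T_\phi)=\{g\in H^2:\phi g\in L^2\}$. For $f\in D(T)\setminus\{0\}$ and $N\ge 0$ define the partial Sarason sub-symbol $R_{f,N}=h_{f,N}/f$, where $$h_{f,N}=\sum_{n=1}^{N}\langle T(fz^n),1\rangle e^{-in\theta}+\sum_{n=0}^{\infty}\langle Tf,z^n\rangle e^{in\theta}\in L^2 .$$ An inner function is a $u\in H^2$ with $|u|=1$ almost everywhere on $\mathbb T$; an outer function is a $g\in H^2$ whose polynomial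 multiples $\{gp: p\text{ a polynomial}\}$ are dense in $H^2$. **Proposition.** Let $T$ be a Sarason-Toeplitz operator and let $f\in D(T)$, $f\neq 0$. Then $f\ne 0$ almost everywhere on $\mathbb T$ (so that each $R_{f,N}$ is defined almost everywhere), and: 1. $T_{R_{f,N}}$ converges to $T$ strongly on $F=\{f p: p\text{ a polynomial}\}$: for every polynomial $p$, $fp\in D(T)$, $fp\in D(T_{R_{f,N}})$ for every $N$, and $T_{R_{f,N}}(fp)\to T(fp)$ in $H^2$ as $N\to\infty$. 2. The operators $T_{R_{f,N}}$, $N\ge 0$, have a common dense domain: $f$ has a factorization $f=f_if_o$ with $f_i$ inner and $f_o$ outer, and for every such factorization the set $\{f_op:p\text{ a polynomial}\}$ is dense in $H^2$ and contained in $D(T_{R_{f,N}})$ for every $N$. -/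

import Mathlib

open MeasureTheory Filter Topology AddCircle Polynomial
open scoped Real ENNReal InnerProductSpace

noncomputable section

namespace SarasonToeplitz

instance factTwoPiPos : Fact (0 < 2 * π) := ⟨Real.two_pi_pos⟩

/-- The unit circle `ℝ / 2πℤ`; the point `θ` stands for `e^{iθ} = fourier 1 θ`. -/
abbrev Torus : Type := AddCircle (2 * π)

/-- Normalised arc length `dθ / 2π` on the circle. -/
abbrev arc : Measure Torus := haarAddCircle

/-- `L²` of the circle. -/
abbrev L2 : Type := Lp ℂ 2 arc

/-- The monomial `z ^ n = e^{inθ}`, `n ∈ ℤ`, as an element of `L²`. -/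
abbrev zPow (n : ℤ) : L2 := fourierLp (T := 2 * π) 2 n

lemma fourierCoeff_eq_inner (f : L2) (n : ℤ) : fourierCoeff f n = ⟪zPow n, f⟫_ℂ := by
  rw [← fourierBasis_repr, HilbertBasis.repr_apply_apply, coe_fourierBasis]

/-- The Hardy space `H²` of the circle: the functions in `L²` whose Fourier coefficients of
negative index vanish. -/
def H2 : Submodule ℂ L2 where
  carrier := {f | ∀ n : ℤ, n < 0 → fourierCoeff f n = 0}
  add_mem' := by
    intro f g hf hg n hn
    have h1 := hf n hn
    have h2 := hg n hn
    rw [fourierCoeff_eq_inner] at h1 h2 ⊢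
    rw [inner_add_right, h1, h2, add_zero]
  zero_mem' := by
    intro n _
    rw [fourierCoeff_eq_inner, inner_zero_right]
  smul_mem' := by
    intro c f hf n hn
    have h1 := hf n hn
    rw [fourierCoeff_eq_inner] at h1 ⊢
    rw [inner_smul_right, h1, mul_zero]

lemma mem_H2 {f : L2} : f ∈ H2 ↔ ∀ n : ℤ, n < 0 → fourierCoeff f n = 0 := Iff.rfl

lemma isClosed_H2 : IsClosed (H2 : Set L2) := by
  have h : (H2 : Set L2) = ⋂ n : ℤ, ⋂ _ : n < 0, {f : L2 | ⟪zPow n, f⟫_ℂ = 0} := by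
    ext f
    simp only [SetLike.mem_coe, mem_H2, fourierCoeff_eq_inner, Set.mem_iInter, Set.mem_ofPred_eq]
  rw [h]
  exact isClosed_iInter fun n => isClosed_iInter fun _ =>
    isClosed_eq (continuous_const.inner continuous_id) continuous_const

instance completeSpace_H2 : CompleteSpace H2 := isClosed_H2.completeSpace_coe

/-- The orthogonal projection `P` of `L²` onto `H²`. -/
def proj : L2 →L[ℂ] H2 := H2.orthogonalProjectionOnto

/-- Multiplication by `z = e^{iθ}` on `L²`. -/
def mulZ : L2 →L[ℂ] L2 :=
  ((ContinuousLinearMap.mul ℂ ℂ).holderL arc ∞ 2 2) (fourierLp ∞ 1)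

lemma coeFn_mulZ (f : L2) : mulZ f =ᵐ[arc] fun θ => fourier 1 θ * f θ := by
  have h := (ContinuousLinearMap.mul ℂ ℂ).coeFn_holder (r := 2) (fourierLp (T := 2 * π) ∞ 1) f
  filter_upwards [h, coeFn_fourierLp (T := 2 * π) ∞ 1] with θ h1 h2
  rw [← h2]
  exact h1

lemma fourierCoeff_mulZ (f : L2) (n : ℤ) : fourierCoeff (mulZ f) n = fourierCoeff f (n - 1) := by
  unfold fourierCoeff
  refine integral_congr_ae ?_
  filter_upwards [coeFn_mulZ f] with θ h
  rw [h, smul_eq_mul, smul_eq_mul, ← mul_assoc, ← fourier_add]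
  congr 3
  ring

/-- The shift `S = M_z` on `H²`. -/
def shift : H2 →L[ℂ] H2 :=
  (mulZ.comp H2.subtypeL).codRestrict H2 fun f n hn => by
    change fourierCoeff (mulZ f) n = 0
    rw [fourierCoeff_mulZ]
    exact f.2 _ (by omega)

lemma coeFn_shift (f : H2) : (shift f : L2) =ᵐ[arc] fun θ => fourier 1 θ * (f : L2) θ :=
  coeFn_mulZ f

/-- `T` has a shift invariant domain. -/
def ShiftInvariantDomain (T : H2 →ₗ.[ℂ] H2) : Prop :=
  ∀ f ∈ T.domain, shift f ∈ T.domain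

/-- A Sarason-Toeplitz operator: a closed densely defined operator `T` on `H²` whose domain is
invariant under `S`, with `S* T S = T` on `D(T)`, and with `S* f ∈ D(T)` whenever `f ∈ D(T)` and
`f(0) = 0` (the value at the origin of the disc is the Fourier coefficient of index `0`). -/
structure IsSarasonToeplitz (T : H2 →ₗ.[ℂ] H2) : Prop where
  closed : T.IsClosed
  dense : Dense (T.domain : Set H2)
  shift_mem : ShiftInvariantDomain T
  adjoint_shift_comp : ∀ f : T.domain,
    ContinuousLinearMap.adjoint shift (T ⟨shift f, shift_mem f f.2⟩) = T f
  adjoint_shift_mem : ∀ f ∈ T.domain, fourierCoeff (f : L2) 0 = 0 →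
    ContinuousLinearMap.adjoint shift f ∈ T.domain

/-- The product `p · f` of a polynomial in `z` and a function `f ∈ H²`, as an element of `H²`. -/
def polyMul (p : ℂ[X]) (f : H2) : H2 := aeval (shift : H2 →L[ℂ] H2) p f

lemma coeFn_polyMul (p : ℂ[X]) (f : H2) :
    (polyMul p f : L2) =ᵐ[arc] fun θ => p.eval (fourier 1 θ) * (f : L2) θ := by
  induction p using Polynomial.induction_on' with
  | add p q hp hq =>
    have h : (polyMul (p + q) f : L2) = (polyMul p f : L2) + (polyMul q f : L2) := by
      simp [polyMul]
    rw [h]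
    filter_upwards [Lp.coeFn_add (polyMul p f : L2) (polyMul q f : L2), hp, hq] with θ h1 h2 h3
    rw [h1, Pi.add_apply, h2, h3, eval_add, add_mul]
  | monomial n a =>
    have hpow : ∀ n : ℕ,
        (((shift ^ n) f : H2) : L2) =ᵐ[arc] fun θ => (fourier 1 θ) ^ n * (f : L2) θ := by
      intro n
      induction n with
      | zero => exact Eventually.of_forall fun θ => by simp
      | succ n ih =>
        have h : (shift ^ (n + 1)) f = shift ((shift ^ n) f) := by
          rw [pow_succ']; rfl
        rw [h]
        filter_upwards [coeFn_shift ((shift ^ n) f), ih] with θ h1 h2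
        rw [h1, h2, pow_succ']
        ring
    have h : (polyMul (monomial n a) f : L2) = a • (((shift ^ n) f : H2) : L2) := by
      simp [polyMul, aeval_monomial, Algebra.algebraMap_eq_smul_one]
    rw [h]
    filter_upwards [Lp.coeFn_smul a (((shift ^ n) f : H2) : L2), hpow n] with θ h1 h2
    rw [h1, Pi.smul_apply, h2, eval_monomial, smul_eq_mul, mul_assoc]

/-- The set `{f · p : p a polynomial}`. -/
def polyMultiples (f : H2) : Set H2 := Set.range fun p : ℂ[X] => polyMul p f

/-- Inner functions: elements of `H²` of modulus `1` almost everywhere on the circle. -/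
def IsInner (u : H2) : Prop := ∀ᵐ θ ∂arc, ‖(u : L2) θ‖ = 1

/-- Outer functions: elements of `H²` that are cyclic for the shift, that is, whose polynomial
multiples are dense in `H²`. -/
def IsOuter (g : H2) : Prop := Dense (polyMultiples g)

/-- `f = u g` is an inner-outer factorization of `f`. -/
def IsInnerOuterFactorization (f u g : H2) : Prop :=
  IsInner u ∧ IsOuter g ∧ (f : L2) =ᵐ[arc] fun θ => (u : L2) θ * (g : L2) θ

lemma mul_add_ae (φ : Torus → ℂ) (f g : H2) :
    (fun θ => φ θ * (f : L2) θ) + (fun θ => φ θ * (g : L2) θ) =ᵐ[arc]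
      fun θ => φ θ * ((f + g : H2) : L2) θ := by
  filter_upwards [Lp.coeFn_add (f : L2) (g : L2)] with θ h
  rw [Submodule.coe_add, h, Pi.add_apply, Pi.add_apply, mul_add]

lemma mul_smul_ae (φ : Torus → ℂ) (c : ℂ) (f : H2) :
    (c • fun θ => φ θ * (f : L2) θ) =ᵐ[arc] fun θ => φ θ * ((c • f : H2) : L2) θ := by
  filter_upwards [Lp.coeFn_smul c (f : L2)] with θ h
  rw [Submodule.coe_smul, h, Pi.smul_apply, Pi.smul_apply, smul_eq_mul, smul_eq_mul,
    mul_left_comm]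

/-- The domain `{f ∈ H² : φ f ∈ L²}` of multiplication by a function `φ` on the circle. -/
def mulDomain (φ : Torus → ℂ) : Submodule ℂ H2 where
  carrier := {f | MemLp (fun θ => φ θ * (f : L2) θ) 2 arc}
  add_mem' {f g} hf hg := (MemLp.add hf hg).ae_eq (mul_add_ae φ f g)
  zero_mem' := by
    refine (MemLp.zero (ε := ℂ) (p := 2) (μ := arc)).ae_eq ?_
    filter_upwards [Lp.coeFn_zero ℂ 2 arc] with θ h
    rw [Submodule.coe_zero, h, Pi.zero_apply, mul_zero]
  smul_mem' c f hf := (MemLp.const_smul hf c).ae_eq (mul_smul_ae φ c f)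

lemma memLp_of_mem_mulDomain {φ : Torus → ℂ} (f : mulDomain φ) :
    MemLp (fun θ => φ θ * ((f : H2) : L2) θ) 2 arc := f.2

/-- The multiplication operator `M_φ : f ↦ φ f` from `H²` to `L²`, with domain
`{f ∈ H² : φ f ∈ L²}`. -/
def mulOp (φ : Torus → ℂ) : H2 →ₗ.[ℂ] L2 where
  domain := mulDomain φ
  toFun :=
    { toFun := fun f => (memLp_of_mem_mulDomain f).toLp _
      map_add' := fun f g => by
        rw [← MemLp.toLp_add]
        exact MemLp.toLp_congr _ _ (mul_add_ae φ f g).symm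
      map_smul' := fun c f => by
        rw [RingHom.id_apply, ← MemLp.toLp_const_smul]
        exact MemLp.toLp_congr _ _ (mul_smul_ae φ c f).symm }

/-- The multiplication type Toeplitz operator `T_φ = P M_φ`, with domain
`{f ∈ H² : φ f ∈ L²}`. -/
def toeplitz (φ : Torus → ℂ) : H2 →ₗ.[ℂ] H2 :=
  (proj : L2 →ₗ[ℂ] H2).compPMap (mulOp φ)

/-- The map `f ↦ z f` of a shift invariant domain into itself. -/
def domainShift {T : H2 →ₗ.[ℂ] H2} (hT : ShiftInvariantDomain T) (f : T.domain) : T.domain :=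
  ⟨shift f, hT f f.2⟩

/-- The numerator of the partial sub-symbol,
`h_{f,N} = ∑_{n=1}^N ⟨T(f zⁿ), 1⟩ e^{-inθ} + ∑_{n=0}^∞ ⟨Tf, zⁿ⟩ e^{inθ}`, the second series being
summed in `L²`. The inner product of Mathlib is conjugate linear in its first argument, so that
`⟨u, v⟩` is `⟪v, u⟫_ℂ`. -/
def partialNumerator {T : H2 →ₗ.[ℂ] H2} (hT : ShiftInvariantDomain T) (f : T.domain) (N : ℕ) :
    L2 :=
  (∑ n ∈ Finset.Icc 1 N, ⟪zPow 0, (T ((domainShift hT)^[n] f) : L2)⟫_ℂ • zPow (-(n : ℤ))) +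
    ∑' n : ℕ, ⟪zPow n, (T f : L2)⟫_ℂ • zPow n

/-- The partial Sarason sub-symbol `R_{f,N} = h_{f,N} / f`, for `f ≠ 0`. -/
def partialSubSymbol {T : H2 →ₗ.[ℂ] H2} (hT : ShiftInvariantDomain T) (f : T.domain) (N : ℕ) :
    Torus → ℂ :=
  fun θ => (partialNumerator hT f N : L2) θ / ((f : H2) : L2) θ

end SarasonToeplitz

end

open SarasonToeplitz

/-!
For `f ≠ 0` in `H²`, let `M` be the closure of the polynomial multiples of `f`. The first nonzero
Fourier coefficient of `f` vanishes on `z M`, so `z M ≠ M`, and a unit vector `u ∈ M` orthogonal to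
`z M` is inner: since `⟪u, zⁿ u⟫ = 0` for `n ≥ 1`, all Fourier coefficients of `|u|² - 1` vanish.
The quotient `g = conj u * f` is analytic since `u ⊥ zⁿ f` for `n ≥ 1`, and it is outer since `u` is a
limit of multiples `f p`, whence `1` is a limit of multiples `g p`. This is the factorization
`f = u g` (`exists_isInnerOuterFactorization`). An outer function is nonzero almost everywhere
(`IsOuter.ae_ne_zero`), hence so is `f`.

The relation `S* T S = T` says that `T (z g) = z T g + ⟨T (z g), 1⟩`. Iterating it shows that
`zᵏ h_{f,N}` differs from `T (zᵏ f)` by negative powers of `z` when `k ≤ N`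
(`mulZ_pow_partialNumerator`). Since `R_{f,N} f p = h_{f,N} p`, the operator `T_{R_{f,N}}` agrees
with `T` on `f p` as soon as `N ≥ deg p`, so the convergence is eventual equality. Finally
`|R_{f,N} f_o p| = |h_{f,N} p|` because `|f_i| = 1`, and `h_{f,N} p` is in `L²`.
-/

noncomputable section

namespace SarasonToeplitz

/-! ### Fourier coefficients and polynomial multiples -/

lemma L2_ext_fourierCoeff {f g : L2} (h : ∀ n : ℤ, fourierCoeff f n = fourierCoeff g n) :
    f = g := by
  refine fourierBasis.repr.injective (lp.ext (funext fun n => ?_))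
  rw [fourierBasis_repr, fourierBasis_repr, h]

lemma inner_zPow (m n : ℤ) : ⟪zPow m, zPow n⟫_ℂ = if m = n then 1 else 0 :=
  orthonormal_iff_ite.mp orthonormal_fourier m n

lemma mulZ_zPow (n : ℤ) : mulZ (zPow n) = zPow (n + 1) := by
  refine L2_ext_fourierCoeff fun m => ?_
  rw [fourierCoeff_mulZ, fourierCoeff_eq_inner, fourierCoeff_eq_inner, inner_zPow, inner_zPow]
  simp only [sub_eq_iff_eq_add]

lemma zPow_mem_H2 (n : ℕ) : zPow n ∈ H2 := by
  intro m hm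
  rw [fourierCoeff_eq_inner, inner_zPow, if_neg (by omega)]

/-- The constant function `1` as an element of `H²`. -/
def hardyOne : H2 := ⟨zPow 0, zPow_mem_H2 0⟩

lemma coe_shift (f : H2) : (shift f : L2) = mulZ (f : L2) := rfl

lemma coe_shift_pow_hardyOne (n : ℕ) : (((shift ^ n) hardyOne : H2) : L2) = zPow n := by
  induction n with
  | zero => rfl
  | succ n ih =>
    have h : (shift ^ (n + 1)) hardyOne = shift ((shift ^ n) hardyOne) := by
      rw [pow_succ']; rfl
    rw [h, coe_shift, ih, mulZ_zPow, Nat.cast_succ]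

/-- The linear map `p ↦ p f` from polynomials to `H²`. -/
def polyMulₗ (f : H2) : ℂ[X] →ₗ[ℂ] H2 where
  toFun p := polyMul p f
  map_add' p q := by simp [polyMul]
  map_smul' c p := by simp [polyMul]

lemma polyMulₗ_apply (f : H2) (p : ℂ[X]) : polyMulₗ f p = polyMul p f := rfl

lemma coe_range_polyMulₗ (f : H2) : (LinearMap.range (polyMulₗ f) : Set H2) = polyMultiples f :=
  LinearMap.coe_range _

lemma polyMul_mul (p q : ℂ[X]) (f : H2) : polyMul (p * q) f = polyMul p (polyMul q f) := by
  simp [polyMul]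

lemma polyMul_X (f : H2) : polyMul X f = shift f := by simp [polyMul]

lemma polyMul_X_pow (n : ℕ) (f : H2) : polyMul (X ^ n) f = (shift ^ n) f := by simp [polyMul]

lemma polyMul_one (f : H2) : polyMul 1 f = f := by simp [polyMul]

lemma coeFn_shift_pow (n : ℕ) (f : H2) :
    (((shift ^ n) f : H2) : L2) =ᵐ[arc] fun θ => fourier n θ * (f : L2) θ := by
  rw [← polyMul_X_pow]
  filter_upwards [coeFn_polyMul (X ^ n) f] with θ h
  rw [h]
  simp [fourier_apply, toCircle_nsmul]

lemma hardy_ext {f g : H2} (h : ∀ n : ℕ, fourierCoeff (f : L2) n = fourierCoeff (g : L2) n) :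
    f = g := by
  refine Subtype.ext (L2_ext_fourierCoeff fun n => ?_)
  rcases lt_or_ge n 0 with hn | hn
  · rw [mem_H2.mp f.2 n hn, mem_H2.mp g.2 n hn]
  · lift n to ℕ using hn
    exact h n

/-! ### Cyclic vectors of the shift -/

lemma isOuter_iff (g : H2) : IsOuter g ↔ (LinearMap.range (polyMulₗ g))ᗮ = ⊥ := by
  rw [IsOuter, ← coe_range_polyMulₗ, Submodule.dense_iff_topologicalClosure_eq_top,
    Submodule.topologicalClosure_eq_top_iff]

lemma shift_mem_closure_range {g w : H2}
    (hw : w ∈ (LinearMap.range (polyMulₗ g)).topologicalClosure) :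
    shift w ∈ (LinearMap.range (polyMulₗ g)).topologicalClosure := by
  have hmaps : Set.MapsTo shift (LinearMap.range (polyMulₗ g) : Set H2)
      (LinearMap.range (polyMulₗ g)) := by
    rintro _ ⟨p, rfl⟩
    exact ⟨X * p, by rw [polyMulₗ_apply, polyMul_mul, polyMul_X, polyMulₗ_apply]⟩
  exact hmaps.closure shift.continuous hw

/-- A function of `H²` is outer as soon as `1` is a limit of polynomial multiples of it. -/
lemma isOuter_of_one_mem_closure {g : H2} (h : hardyOne ∈ closure (polyMultiples g)) :
    IsOuter g := by
  rw [isOuter_iff, ← Submodule.orthogonal_closure, Submodule.eq_bot_iff]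
  intro w hw
  have hpow : ∀ n : ℕ, (shift ^ n) hardyOne ∈
      (LinearMap.range (polyMulₗ g)).topologicalClosure := by
    intro n
    induction n with
    | zero =>
      rw [← coe_range_polyMulₗ] at h
      exact h
    | succ n ih =>
      rw [pow_succ']
      exact shift_mem_closure_range ih
  refine hardy_ext fun n => ?_
  have h1 := Submodule.inner_right_of_mem_orthogonal (hpow n) hw
  rw [Submodule.coe_inner, coe_shift_pow_hardyOne] at h1
  rw [fourierCoeff_eq_inner, h1, fourierCoeff_eq_inner, Submodule.coe_zero, inner_zero_right]

/-- An outer function cannot vanish on a set `E` of positive measure: all its polynomial multiples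
would be orthogonal to `1_E`, whereas `1 ∈ H²` is not. -/
lemma IsOuter.ae_ne_zero {g : H2} (hg : IsOuter g) : ∀ᵐ θ ∂arc, (g : L2) θ ≠ 0 := by
  set E : Set Torus := {θ | (g : L2) θ = 0}
  have hEm : MeasurableSet E :=
    (Lp.stronglyMeasurable (g : L2)).measurable (measurableSet_singleton 0)
  have hEf : arc E ≠ ∞ := measure_ne_top _ _
  have hclosed : IsClosed {w : H2 | ⟪indicatorConstLp 2 hEm hEf (1 : ℂ), (w : L2)⟫_ℂ = 0} :=
    isClosed_eq (continuous_const.inner continuous_subtype_val) continuous_const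
  have hsub : polyMultiples g ⊆
      {w : H2 | ⟪indicatorConstLp 2 hEm hEf (1 : ℂ), (w : L2)⟫_ℂ = 0} := by
    rintro _ ⟨p, rfl⟩
    change ⟪indicatorConstLp 2 hEm hEf (1 : ℂ), (polyMul p g : L2)⟫_ℂ = 0
    rw [L2.inner_indicatorConstLp_one]
    refine (setIntegral_congr_ae hEm (g := fun _ => (0 : ℂ)) ?_).trans (by simp)
    filter_upwards [coeFn_polyMul p g] with θ h hθ
    rw [h, show (g : L2) θ = 0 from hθ, mul_zero]
  have hone : ⟪indicatorConstLp 2 hEm hEf (1 : ℂ), (hardyOne : L2)⟫_ℂ = 0 :=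
    closure_minimal hsub hclosed (hg hardyOne)
  rw [L2.inner_indicatorConstLp_one] at hone
  have hint : ∫ θ in E, (hardyOne : L2) θ ∂arc = ∫ _ in E, (1 : ℂ) ∂arc := by
    refine setIntegral_congr_ae hEm ?_
    filter_upwards [coeFn_fourierLp (T := 2 * π) 2 0] with θ h _
    exact h.trans fourier_zero
  rw [hint, setIntegral_const, Complex.real_smul, mul_one, Complex.ofReal_eq_zero,
    measureReal_eq_zero_iff hEf] at hone
  exact measure_eq_zero_iff_ae_notMem.mp hone

/-! ### Inner-outer factorization -/

/-- An integrable function on the circle all of whose Fourier coefficients vanish annihilates the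
continuous functions. -/
lemma integral_mul_eq_zero_of_fourierCoeff_eq_zero {F : Torus → ℂ} (hF : Integrable F arc)
    (h : ∀ n : ℤ, ∫ θ, fourier n θ * F θ ∂arc = 0) (φ : C(Torus, ℂ)) :
    ∫ θ, φ θ * F θ ∂arc = 0 := by
  have hint : ∀ ψ : C(Torus, ℂ), Integrable (fun θ => ψ θ * F θ) arc := fun ψ =>
    hF.bdd_mul ψ.continuous.aestronglyMeasurable (Eventually.of_forall ψ.norm_coe_le_norm)
  let Λ : C(Torus, ℂ) →ₗ[ℂ] ℂ :=
    { toFun := fun ψ => ∫ θ, ψ θ * F θ ∂arc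
      map_add' := fun ψ χ => by
        rw [← integral_add (hint ψ) (hint χ)]
        simp only [ContinuousMap.add_apply, add_mul]
      map_smul' := fun c ψ => by
        rw [RingHom.id_apply, smul_eq_mul, ← integral_const_mul]
        simp only [ContinuousMap.smul_apply, smul_eq_mul, mul_assoc] }
  have hbound : ∀ ψ, ‖Λ ψ‖ ≤ (∫ θ, ‖F θ‖ ∂arc) * ‖ψ‖ := fun ψ => by
    rw [← integral_mul_const]
    refine norm_integral_le_of_norm_le (hF.norm.mul_const _) (Eventually.of_forall fun θ => ?_)
    rw [norm_mul, mul_comm]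
    exact mul_le_mul_of_nonneg_left (ψ.norm_coe_le_norm θ) (norm_nonneg _)
  let Λc : C(Torus, ℂ) →L[ℂ] ℂ := Λ.mkContinuous _ hbound
  have hle : Submodule.span ℂ (Set.range (fourier (T := 2 * π))) ≤ Λc.ker := by
    rw [Submodule.span_le]
    rintro _ ⟨n, rfl⟩
    exact h n
  have htop := Submodule.topologicalClosure_minimal _ hle Λc.isClosed_ker
  rw [span_fourier_closure_eq_top] at htop
  exact htop (Submodule.mem_top (x := φ))

/-- A unit vector of `H²` orthogonal to all its proper shifts is inner, because the Fourier
coefficients of `|u|² - 1` vanish. -/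
lemma isInner_of_inner_shift_pow {u : H2} (hu : ‖u‖ = 1)
    (h : ∀ n : ℕ, n ≠ 0 → ⟪u, (shift ^ n) u⟫_ℂ = 0) : IsInner u := by
  have hsq : Integrable (fun θ => ‖(u : L2) θ‖ ^ 2) arc :=
    (memLp_two_iff_integrable_sq_norm (Lp.aestronglyMeasurable _)).mp (Lp.memLp (u : L2))
  have hF : Integrable (fun θ => ((‖(u : L2) θ‖ ^ 2 - 1 : ℝ) : ℂ)) arc :=
    (hsq.sub (integrable_const 1)).ofReal
  have hint1 : Integrable (fun θ => ((‖(u : L2) θ‖ ^ 2 : ℝ) : ℂ)) arc := hsq.ofReal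
  have hcoef : ∀ n : ℕ, ∫ θ, fourier n θ * ((‖(u : L2) θ‖ ^ 2 : ℝ) : ℂ) ∂arc =
      ⟪u, (shift ^ n) u⟫_ℂ := by
    intro n
    rw [Submodule.coe_inner, L2.inner_def]
    refine integral_congr_ae ?_
    filter_upwards [coeFn_shift_pow n u] with θ hθ
    rw [hθ, RCLike.inner_apply, mul_assoc, Complex.mul_conj, Complex.normSq_eq_norm_sq]
  have hfour : ∀ n : ℕ, ∫ θ, fourier n θ ∂arc = if n = 0 then 1 else 0 := by
    intro n
    have h1 := inner_zPow 0 n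
    rw [ContinuousMap.inner_toLp] at h1
    simp only [fourier_zero, map_one, mul_one] at h1
    rw [h1]
    simp [eq_comm]
  have hnonneg : ∀ n : ℕ, ∫ θ, fourier n θ * ((‖(u : L2) θ‖ ^ 2 - 1 : ℝ) : ℂ) ∂arc = 0 := by
    intro n
    have hb : ∀ θ : Torus, ‖fourier (n : ℤ) θ‖ ≤ 1 := fun θ => by
      rw [fourier_apply, Circle.norm_coe]
    have hm : AEStronglyMeasurable (fun θ : Torus => fourier (n : ℤ) θ) arc :=
      (fourier (n : ℤ)).continuous.aestronglyMeasurable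
    simp only [Complex.ofReal_sub, mul_sub, Complex.ofReal_one, mul_one]
    rw [integral_sub (hint1.bdd_mul hm (Eventually.of_forall hb))
      ((integrable_const (1 : ℝ)).mono' hm (Eventually.of_forall hb)), hcoef, hfour]
    by_cases hn : n = 0
    · have hself : ⟪u, u⟫_ℂ = 1 := inner_self_eq_one_of_norm_eq_one hu
      rw [hn, pow_zero, one_apply_eq_self, hself, if_pos rfl, sub_self]
    · rw [h n hn, if_neg hn, sub_zero]
  have hall : ∀ n : ℤ, ∫ θ, fourier n θ * ((‖(u : L2) θ‖ ^ 2 - 1 : ℝ) : ℂ) ∂arc = 0 := by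
    intro n
    obtain ⟨m, rfl | rfl⟩ := n.eq_nat_or_neg
    · exact hnonneg m
    · have h1 := congrArg (starRingEnd ℂ) (hnonneg m)
      rw [← integral_conj, map_zero] at h1
      rw [← h1]
      refine integral_congr_ae (Eventually.of_forall fun θ => ?_)
      simp only [fourier_neg, map_mul, Complex.conj_ofReal]
  have hcont := integral_mul_eq_zero_of_fourierCoeff_eq_zero hF hall
  -- `|u|² dθ` and `dθ` agree on continuous functions, so they are the same measure.
  have hdens : AEMeasurable (fun θ => ENNReal.ofReal (‖(u : L2) θ‖ ^ 2)) arc :=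
    hsq.aestronglyMeasurable.aemeasurable.ennreal_ofReal
  have hfin : IsFiniteMeasure (arc.withDensity fun θ => ENNReal.ofReal (‖(u : L2) θ‖ ^ 2)) :=
    isFiniteMeasure_withDensity_ofReal hsq.2
  have hmeas : (arc.withDensity fun θ => ENNReal.ofReal (‖(u : L2) θ‖ ^ 2)) = arc := by
    refine ext_of_forall_integral_eq_of_IsFiniteMeasure fun φ => ?_
    have hφ := hcont ⟨fun θ => (φ θ : ℂ), Complex.continuous_ofReal.comp φ.continuous⟩
    simp only [ContinuousMap.coe_mk, ← Complex.ofReal_mul] at hφ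
    rw [integral_complex_ofReal, Complex.ofReal_eq_zero] at hφ
    rw [integral_withDensity_eq_integral_toReal_smul₀ hdens
      (Eventually.of_forall fun θ => ENNReal.ofReal_lt_top)]
    have hm : AEStronglyMeasurable (fun θ : Torus => φ θ) arc :=
      φ.continuous.aestronglyMeasurable
    have hb : ∀ᵐ θ ∂arc, ‖φ θ‖ ≤ ‖φ‖ := Eventually.of_forall φ.norm_coe_le_norm
    simp only [mul_sub, mul_one] at hφ
    rw [integral_sub (hsq.bdd_mul hm hb) ((integrable_const ‖φ‖).mono' hm hb), sub_eq_zero] at hφ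
    rw [← hφ]
    refine integral_congr_ae (Eventually.of_forall fun θ => ?_)
    simp only [ENNReal.toReal_ofReal (sq_nonneg ‖(u : L2) θ‖), smul_eq_mul]
    rw [mul_comm]
  have hone := (withDensity_eq_iff_of_sigmaFinite (g := 1) hdens aemeasurable_const).mp
    (hmeas.trans withDensity_one.symm)
  filter_upwards [hone] with θ hθ
  rw [Pi.one_apply, ENNReal.ofReal_eq_one] at hθ
  exact (pow_eq_one_iff_of_nonneg (norm_nonneg _) two_ne_zero).mp hθ

/-- In the closure `M` of the polynomial multiples of `f ≠ 0` there is an inner function orthogonal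
to `z M`, the *wandering vector* of Beurling's theorem. -/
lemma exists_inner_mem_closure {f : H2} (hf : f ≠ 0) :
    ∃ u : H2, IsInner u ∧ u ∈ closure (polyMultiples f) ∧
      ∀ n : ℕ, n ≠ 0 → ⟪u, (shift ^ n) f⟫_ℂ = 0 := by
  classical
  set M := (LinearMap.range (polyMulₗ f)).topologicalClosure
  set K := (LinearMap.range (polyMulₗ (shift f))).topologicalClosure
  have hKcomplete : CompleteSpace K :=
    (Submodule.isClosed_topologicalClosure _).completeSpace_coe
  have hshiftMK : ∀ w ∈ M, shift w ∈ K := by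
    have hmaps : Set.MapsTo shift (LinearMap.range (polyMulₗ f) : Set H2)
        (LinearMap.range (polyMulₗ (shift f))) := by
      rintro _ ⟨p, rfl⟩
      refine ⟨p, ?_⟩
      rw [polyMulₗ_apply, polyMulₗ_apply, ← polyMul_X, ← polyMul_X, ← polyMul_mul, ← polyMul_mul,
        mul_comm p X]
    exact fun w hw => hmaps.closure shift.continuous hw
  have hKM : K ≤ M := by
    refine Submodule.topologicalClosure_mono ?_
    rintro _ ⟨p, rfl⟩
    exact ⟨p * X, by rw [polyMulₗ_apply, polyMulₗ_apply, polyMul_mul, polyMul_X]⟩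
  have hfM : f ∈ M := Submodule.le_topologicalClosure _ ⟨1, polyMul_one f⟩
  -- The first nonzero Fourier coefficient of `f` vanishes on `K`, which keeps `f` out of `K`.
  have hfK : f ∉ K := by
    have hex : ∃ n : ℕ, fourierCoeff (f : L2) n ≠ 0 := by
      by_contra! hall
      refine hf (hardy_ext fun n => ?_)
      rw [hall, fourierCoeff_eq_inner, Submodule.coe_zero, inner_zero_right]
    set m := Nat.find hex
    have hlow : ∀ k : ℤ, k < m → fourierCoeff (f : L2) k = 0 := by
      intro k hk
      rcases lt_or_ge k 0 with hk0 | hk0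
      · exact f.2 k hk0
      · lift k to ℕ using hk0
        exact not_not.mp (Nat.find_min hex (by exact_mod_cast hk))
    have hpow : ∀ (n : ℕ) (k : ℤ), k < m → fourierCoeff (((shift ^ n) f : H2) : L2) k = 0 := by
      intro n
      induction n with
      | zero => exact hlow
      | succ n ih =>
        intro k hk
        rw [pow_succ']
        change fourierCoeff (mulZ (((shift ^ n) f : H2) : L2)) k = 0
        rw [fourierCoeff_mulZ]
        exact ih _ (by omega)
    have hclosed : IsClosed {w : H2 | ⟪zPow m, (w : L2)⟫_ℂ = 0} :=
      isClosed_eq (continuous_const.inner continuous_subtype_val) continuous_const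
    have hsub : (LinearMap.range (polyMulₗ (shift f)) : Set H2) ⊆
        {w : H2 | ⟪zPow m, (w : L2)⟫_ℂ = 0} := by
      rintro _ ⟨p, rfl⟩
      change ⟪zPow m, (polyMul p (shift f) : L2)⟫_ℂ = 0
      induction p using Polynomial.induction_on' with
      | add p q hp hq =>
        have h : polyMul (p + q) (shift f) = polyMul p (shift f) + polyMul q (shift f) :=
          (polyMulₗ (shift f)).map_add p q
        rw [h, Submodule.coe_add, inner_add_right, hp, hq, add_zero]
      | monomial n a =>
        have h : polyMul (monomial n a) (shift f) = a • (shift ((shift ^ n) f)) := by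
          rw [← polyMul_X, ← polyMul_mul, ← C_mul_X_pow_eq_monomial, mul_assoc, ← smul_eq_C_mul,
            ← pow_succ, ← polyMulₗ_apply, map_smul, polyMulₗ_apply, polyMul_X_pow, pow_succ']
          rfl
        rw [h, Submodule.coe_smul, inner_smul_right, coe_shift, ← fourierCoeff_eq_inner,
          fourierCoeff_mulZ, hpow n _ (by omega), mul_zero]
    intro hmem
    have h0 : ⟪zPow m, (f : L2)⟫_ℂ = 0 := closure_minimal hsub hclosed hmem
    rw [← fourierCoeff_eq_inner] at h0
    exact Nat.find_spec hex h0
  set v := f - K.starProjection f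
  have hvorth : v ∈ Kᗮ := K.sub_starProjection_mem_orthogonal f
  have hvM : v ∈ M := M.sub_mem hfM (hKM (K.starProjection_apply_mem f))
  have hv0 : v ≠ 0 := fun h => hfK ((K.starProjection_eq_self_iff).mp (sub_eq_zero.mp h).symm)
  set u : H2 := ((‖v‖⁻¹ : ℝ) : ℂ) • v with hu
  have hunorm : ‖u‖ = 1 := by
    rw [hu, norm_smul, Complex.norm_real, norm_inv, norm_norm,
      inv_mul_cancel₀ (norm_ne_zero_iff.mpr hv0)]
  have huM : u ∈ M := M.smul_mem _ hvM
  have huorth : u ∈ Kᗮ := Kᗮ.smul_mem _ hvorth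
  have hpowK : ∀ w ∈ M, ∀ n : ℕ, n ≠ 0 → (shift ^ n) w ∈ K := by
    intro w hw n hn
    obtain ⟨k, rfl⟩ := Nat.exists_eq_succ_of_ne_zero hn
    rw [Nat.succ_eq_add_one, pow_succ']
    refine hshiftMK _ ?_
    clear hn
    induction k with
    | zero => exact hw
    | succ k ih =>
      rw [pow_succ']
      exact shift_mem_closure_range ih
  have horth : ∀ w ∈ M, ∀ n : ℕ, n ≠ 0 → ⟪u, (shift ^ n) w⟫_ℂ = 0 := fun w hw n hn =>
    Submodule.inner_left_of_mem_orthogonal (hpowK w hw n hn) huorth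
  refine ⟨u, isInner_of_inner_shift_pow hunorm (horth u huM), ?_, horth f hfM⟩
  rw [← coe_range_polyMulₗ]
  exact huM

theorem exists_isInnerOuterFactorization {f : H2} (hf : f ≠ 0) :
    ∃ u g : H2, IsInnerOuterFactorization f u g := by
  obtain ⟨u, hu, huM, horth⟩ := exists_inner_mem_closure hf
  have hmem : MemLp (fun θ => (starRingEnd ℂ) ((u : L2) θ) * (f : L2) θ) 2 arc := by
    refine MemLp.of_le (Lp.memLp (f : L2)) ?_ ?_
    · exact (Complex.continuous_conj.comp_aestronglyMeasurable
        (Lp.aestronglyMeasurable (u : L2))).mul (Lp.aestronglyMeasurable (f : L2))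
    · filter_upwards [hu] with θ h
      rw [norm_mul, RCLike.norm_conj, h, one_mul]
  -- `conj u * f` is analytic since `u` is orthogonal to `zⁿ f` for `n ≥ 1`.
  have hH2 : hmem.toLp _ ∈ H2 := by
    intro n hn
    obtain ⟨m, rfl⟩ : ∃ m : ℕ, n = -(m : ℤ) := ⟨n.natAbs, by omega⟩
    rw [← horth m (by omega), Submodule.coe_inner, L2.inner_def]
    refine integral_congr_ae ?_
    filter_upwards [hmem.coeFn_toLp, coeFn_shift_pow m f] with θ h1 h2
    rw [h1, h2, RCLike.inner_apply, neg_neg, smul_eq_mul]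
    ring
  set g : H2 := ⟨hmem.toLp _, hH2⟩
  have hfac : (f : L2) =ᵐ[arc] fun θ => (u : L2) θ * (g : L2) θ := by
    filter_upwards [hmem.coeFn_toLp, hu] with θ h1 h2
    change _ = _ * (hmem.toLp _ : L2) θ
    rw [h1, ← mul_assoc, Complex.mul_conj, Complex.normSq_eq_norm_sq, h2]
    simp
  refine ⟨u, g, hu, isOuter_of_one_mem_closure ?_, hfac⟩
  -- `p f → u` implies `p g → 1`, as multiplication by `u` is isometric.
  rw [Metric.mem_closure_iff] at huM ⊢
  intro ε hε
  obtain ⟨_, ⟨p, rfl⟩, hp⟩ := huM ε hε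
  refine ⟨_, ⟨p, rfl⟩, lt_of_le_of_lt ?_ hp⟩
  rw [dist_eq_norm, dist_eq_norm, Submodule.coe_norm, Submodule.coe_norm, Submodule.coe_sub,
    Submodule.coe_sub]
  refine Lp.norm_le_norm_of_ae_le ?_
  filter_upwards [Lp.coeFn_sub (hardyOne : L2) (polyMul p g : L2),
    Lp.coeFn_sub (u : L2) (polyMul p f : L2), coeFn_polyMul p f, coeFn_polyMul p g, hfac, hu,
    coeFn_fourierLp (T := 2 * π) 2 0] with θ h1 h2 h3 h4 h5 h6 h7
  have h8 : (hardyOne : L2) θ = 1 := h7.trans fourier_zero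
  rw [h1, h2, Pi.sub_apply, Pi.sub_apply, h3, h4, h5, h8]
  rw [show (u : L2) θ - p.eval (fourier 1 θ) * ((u : L2) θ * (g : L2) θ) =
    (u : L2) θ * (1 - p.eval (fourier 1 θ) * (g : L2) θ) by ring, norm_mul, h6, one_mul]

/-- A nonzero function of `H²` vanishes almost nowhere on the circle. -/
theorem ae_ne_zero {f : H2} (hf : f ≠ 0) : ∀ᵐ θ ∂arc, (f : L2) θ ≠ 0 := by
  obtain ⟨u, g, hu, hg, hfac⟩ := exists_isInnerOuterFactorization hf
  filter_upwards [hu, hg.ae_ne_zero, hfac] with θ h1 h2 h3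
  rw [h3]
  exact mul_ne_zero (norm_ne_zero_iff.mp (h1 ▸ one_ne_zero)) h2


/-! ### Toeplitz operators with sub-symbols -/

lemma coe_adjoint_shift_add (w : H2) :
    mulZ (ContinuousLinearMap.adjoint shift w : L2) + ⟪zPow 0, (w : L2)⟫_ℂ • zPow 0 = w := by
  refine L2_ext_fourierCoeff fun n => ?_
  rw [fourierCoeff_eq_inner, inner_add_right, ← fourierCoeff_eq_inner, fourierCoeff_mulZ,
    inner_smul_right, inner_zPow]
  rcases lt_trichotomy n 0 with hn | rfl | hn
  · rw [mem_H2.mp w.2 n hn, if_neg hn.ne, mul_zero, add_zero]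
    exact (ContinuousLinearMap.adjoint shift w).2 _ (by omega)
  · rw [if_pos rfl, mul_one, fourierCoeff_eq_inner _ 0,
      mem_H2.mp (ContinuousLinearMap.adjoint shift w).2 _ (by omega), zero_add]
  · obtain ⟨m, rfl⟩ : ∃ m : ℕ, n = m + 1 := ⟨(n - 1).toNat, by omega⟩
    rw [if_neg hn.ne', mul_zero, add_zero, add_sub_cancel_right, fourierCoeff_eq_inner,
      fourierCoeff_eq_inner, ← coe_shift_pow_hardyOne, ← Submodule.coe_inner,
      ContinuousLinearMap.adjoint_inner_right, Submodule.coe_inner, coe_shift,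
      coe_shift_pow_hardyOne, mulZ_zPow]

/-- The relation `S* T S = T` says that `T (z g)` and `z T g` differ by a constant. -/
lemma IsSarasonToeplitz.map_domainShift {T : H2 →ₗ.[ℂ] H2} (hT : IsSarasonToeplitz T)
    (g : T.domain) :
    (T (domainShift hT.shift_mem g) : L2) =
      mulZ (T g : L2) + ⟪zPow 0, (T (domainShift hT.shift_mem g) : L2)⟫_ℂ • zPow 0 := by
  have h := coe_adjoint_shift_add (T (domainShift hT.shift_mem g))
  rw [show ContinuousLinearMap.adjoint shift (T (domainShift hT.shift_mem g)) = T g from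
    hT.adjoint_shift_comp g] at h
  exact h.symm

lemma tsum_inner_zPow (w : H2) : ∑' n : ℕ, ⟪zPow n, (w : L2)⟫_ℂ • zPow n = (w : L2) := by
  have h := hasSum_fourier_series_L2 (w : L2)
  rw [← Nat.cast_injective.hasSum_iff (g := ((↑) : ℕ → ℤ))] at h
  · simp_rw [← fourierCoeff_eq_inner]
    exact h.tsum_eq
  · intro n hn
    rw [mem_H2.mp w.2 n, zero_smul]
    by_contra! h0
    exact hn ⟨n.toNat, Int.toNat_of_nonneg h0⟩

/-- For `k ≤ N`, the function `zᵏ h_{f,N}` differs from `T (zᵏ f)` by a combination of negative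
powers of `z`. -/
lemma mulZ_pow_partialNumerator {T : H2 →ₗ.[ℂ] H2} (hT : IsSarasonToeplitz T) (f : T.domain)
    {k N : ℕ} (hk : k ≤ N) :
    (mulZ ^ k) (partialNumerator hT.shift_mem f N) =
      (∑ n ∈ Finset.Ioc k N, ⟪zPow 0, (T ((domainShift hT.shift_mem)^[n] f) : L2)⟫_ℂ •
        zPow ((k : ℤ) - n)) + (T ((domainShift hT.shift_mem)^[k] f) : L2) := by
  induction k with
  | zero =>
    rw [pow_zero, one_apply_eq_self, partialNumerator, tsum_inner_zPow, Function.iterate_zero_apply]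
    simp only [Nat.cast_zero, zero_sub]
    rfl
  | succ k ih =>
    have h : (mulZ ^ (k + 1)) (partialNumerator hT.shift_mem f N) =
        mulZ ((mulZ ^ k) (partialNumerator hT.shift_mem f N)) := by
      rw [pow_succ']; rfl
    rw [h, ih (by omega), map_add, map_sum, ← Finset.insert_Ioc_add_one_left_eq_Ioc (by omega),
      Finset.sum_insert (by simp)]
    simp only [map_smul, mulZ_zPow]
    have h0 : (k : ℤ) - ((k + 1 : ℕ) : ℤ) + 1 = 0 := by push_cast; ring
    have h1 : ∀ n : ℕ, (k : ℤ) - n + 1 = ((k + 1 : ℕ) : ℤ) - n := fun n => by push_cast; ring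
    rw [h0]
    simp only [h1]
    have h2 : (domainShift hT.shift_mem)^[k + 1] f =
        domainShift hT.shift_mem ((domainShift hT.shift_mem)^[k] f) :=
      Function.iterate_succ_apply' _ _ _
    have h3 := hT.map_domainShift ((domainShift hT.shift_mem)^[k] f)
    rw [← h2] at h3
    conv_rhs => rw [h3]
    abel

lemma proj_coe (w : H2) : proj (w : L2) = w :=
  Submodule.orthogonalProjectionOnto_mem_subspace_eq_self w

lemma proj_zPow_of_neg {n : ℤ} (hn : n < 0) : proj (zPow n) = 0 := by
  refine Submodule.orthogonalProjectionOnto_apply_of_mem_orthogonal ?_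
  rw [Submodule.mem_orthogonal']
  intro w hw
  rw [← fourierCoeff_eq_inner]
  exact hw n hn

lemma proj_mulZ_pow_partialNumerator {T : H2 →ₗ.[ℂ] H2} (hT : IsSarasonToeplitz T)
    (f : T.domain) {k N : ℕ} (hk : k ≤ N) :
    proj ((mulZ ^ k) (partialNumerator hT.shift_mem f N)) =
      T ((domainShift hT.shift_mem)^[k] f) := by
  rw [mulZ_pow_partialNumerator hT f hk, map_add, proj_coe, map_sum, Finset.sum_eq_zero, zero_add]
  intro n hn
  rw [map_smul, proj_zPow_of_neg (by have := (Finset.mem_Ioc.mp hn).1; omega), smul_zero]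

lemma coeFn_mulZ_pow (k : ℕ) (w : L2) :
    (mulZ ^ k) w =ᵐ[arc] fun θ => (fourier 1 θ) ^ k * w θ := by
  induction k with
  | zero => exact Eventually.of_forall fun θ => by simp
  | succ k ih =>
    have h : (mulZ ^ (k + 1)) w = mulZ ((mulZ ^ k) w) := by rw [pow_succ']; rfl
    rw [h]
    filter_upwards [coeFn_mulZ ((mulZ ^ k) w), ih] with θ h1 h2
    rw [h1, h2, pow_succ']
    ring

lemma memLp_eval_mul (p : ℂ[X]) (w : L2) :
    MemLp (fun θ => p.eval (fourier 1 θ) * w θ) 2 arc := by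
  have hcont : Continuous fun θ : Torus => p.eval (fourier 1 θ) :=
    p.continuous.comp (fourier 1).continuous
  let ψ : C(Torus, ℂ) := ⟨_, hcont⟩
  refine MemLp.of_le_mul (c := ‖ψ‖) (Lp.memLp w)
    (hcont.aestronglyMeasurable.mul (Lp.aestronglyMeasurable w)) (Eventually.of_forall fun θ => ?_)
  rw [norm_mul]
  exact mul_le_mul_of_nonneg_right (ψ.norm_coe_le_norm θ) (norm_nonneg _)

lemma toeplitz_apply_of_ae_eq {φ : Torus → ℂ} {g : H2} {w : L2} (hg : g ∈ (toeplitz φ).domain)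
    (h : (w : Torus → ℂ) =ᵐ[arc] fun θ => φ θ * (g : L2) θ) :
    toeplitz φ ⟨g, hg⟩ = proj w := by
  have hg' : MemLp (fun θ => φ θ * (g : L2) θ) 2 arc := hg
  change proj (hg'.toLp _) = proj w
  congr 1
  exact Lp.ext (hg'.coeFn_toLp.trans h.symm)

lemma polyMul_mem_domain {T : H2 →ₗ.[ℂ] H2} (hT : ShiftInvariantDomain T) (f : T.domain)
    (p : ℂ[X]) : polyMul p f ∈ T.domain := by
  induction p using Polynomial.induction_on' with
  | add p q hp hq =>
    rw [← polyMulₗ_apply, map_add]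
    exact T.domain.add_mem hp hq
  | monomial n a =>
    have h : polyMul (monomial n a) (f : H2) = a • (shift ^ n) (f : H2) := by
      rw [← polyMul_X_pow, ← polyMulₗ_apply, ← polyMulₗ_apply, ← map_smul, smul_X_eq_monomial]
    rw [h]
    refine T.domain.smul_mem a ?_
    induction n with
    | zero => exact f.2
    | succ n ih =>
      rw [pow_succ']
      exact hT _ (ih (by rw [← polyMul_X_pow, ← polyMulₗ_apply, ← polyMulₗ_apply, ← map_smul,
        smul_X_eq_monomial]))

lemma coe_domainShift_iterate {T : H2 →ₗ.[ℂ] H2} (hT : ShiftInvariantDomain T) (f : T.domain)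
    (k : ℕ) : (((domainShift hT)^[k] f : T.domain) : H2) = (shift ^ k) (f : H2) := by
  induction k with
  | zero => rfl
  | succ k ih =>
    rw [Function.iterate_succ_apply', pow_succ']
    change shift (((domainShift hT)^[k] f : T.domain) : H2) = shift ((shift ^ k) (f : H2))
    rw [ih]

lemma polyMul_mem_toeplitz_domain {T : H2 →ₗ.[ℂ] H2} (hT : ShiftInvariantDomain T) (f : T.domain)
    (hf : ∀ᵐ θ ∂arc, ((f : H2) : L2) θ ≠ 0) (N : ℕ) (p : ℂ[X]) :
    polyMul p f ∈ (toeplitz (partialSubSymbol hT f N)).domain := by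
  refine (memLp_eval_mul p (partialNumerator hT f N)).ae_eq ?_
  filter_upwards [hf, coeFn_polyMul p (f : H2)] with θ h1 h2
  rw [h2, partialSubSymbol]
  field_simp

/-- `T_{R_{f,N}}` agrees with `T` on `f p` once `N` is at least the degree of `p`. -/
lemma eventually_toeplitz_eq {T : H2 →ₗ.[ℂ] H2} (hT : IsSarasonToeplitz T) (f : T.domain)
    (hf : ∀ᵐ θ ∂arc, ((f : H2) : L2) θ ≠ 0) (p : ℂ[X]) :
    ∀ᶠ N in atTop,
      toeplitz (partialSubSymbol hT.shift_mem f N)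
        ⟨polyMul p f, polyMul_mem_toeplitz_domain hT.shift_mem f hf N p⟩ =
      T ⟨polyMul p f, polyMul_mem_domain hT.shift_mem f p⟩ := by
  let A : ℂ[X] →ₗ[ℂ] T.domain :=
    (polyMulₗ (f : H2)).codRestrict T.domain (polyMul_mem_domain hT.shift_mem f)
  let B (N : ℕ) : ℂ[X] →ₗ[ℂ] (toeplitz (partialSubSymbol hT.shift_mem f N)).domain :=
    (polyMulₗ (f : H2)).codRestrict _ (polyMul_mem_toeplitz_domain hT.shift_mem f hf N)
  change ∀ᶠ N in atTop, (toeplitz (partialSubSymbol hT.shift_mem f N)).toFun (B N p) = T.toFun (A p)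
  induction p using Polynomial.induction_on' with
  | add p q hp hq =>
    filter_upwards [hp, hq] with N h1 h2
    rw [map_add, map_add, map_add, map_add, h1, h2]
  | monomial k a =>
    filter_upwards [eventually_ge_atTop k] with N hN
    rw [← smul_X_eq_monomial, map_smul, map_smul, map_smul, map_smul]
    congr 1
    have hA : A (X ^ k) = (domainShift hT.shift_mem)^[k] f :=
      Subtype.ext ((polyMul_X_pow k (f : H2)).trans
        (coe_domainShift_iterate hT.shift_mem f k).symm)
    rw [hA]
    refine (toeplitz_apply_of_ae_eq _ ?_).trans (proj_mulZ_pow_partialNumerator hT f hN)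
    filter_upwards [hf, coeFn_polyMul (X ^ k) (f : H2),
      coeFn_mulZ_pow k (partialNumerator hT.shift_mem f N)] with θ h1 h2 h3
    change _ = _ * (polyMul (X ^ k) (f : H2) : L2) θ
    rw [h3, h2, partialSubSymbol, eval_pow, eval_X]
    field_simp

/-- The product of `R_{f,N}` with the outer factor of `f` has the modulus of `h_{f,N}`. -/
lemma polyMultiples_subset_toeplitz_domain {T : H2 →ₗ.[ℂ] H2} (hT : ShiftInvariantDomain T)
    (f : T.domain) {u g : H2} (h : IsInnerOuterFactorization f u g) (N : ℕ) :
    polyMultiples g ⊆ (toeplitz (partialSubSymbol hT f N)).domain := by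
  rintro _ ⟨p, rfl⟩
  obtain ⟨hu, hg, hfac⟩ := h
  have hmeas : AEStronglyMeasurable (fun θ => partialSubSymbol hT f N θ * (polyMul p g : L2) θ)
      arc := by
    have hdiv : AEStronglyMeasurable (partialSubSymbol hT f N) arc :=
      ((Lp.stronglyMeasurable _).measurable.div
        (Lp.stronglyMeasurable _).measurable).aestronglyMeasurable
    exact hdiv.mul (Lp.aestronglyMeasurable _)
  refine MemLp.of_le (memLp_eval_mul p (partialNumerator hT f N)) hmeas ?_
  filter_upwards [hu, hg.ae_ne_zero, hfac, coeFn_polyMul p g] with θ h1 h2 h3 h4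
  rw [h4, partialSubSymbol, h3, norm_mul, norm_div, norm_mul, norm_mul, norm_mul, h1, one_mul]
  have h5 : ‖(g : L2) θ‖ ≠ 0 := norm_ne_zero_iff.mpr h2
  field_simp
  exact le_refl _

end SarasonToeplitz

end

theorem mainTheorem7 (T : H2 →ₗ.[ℂ] H2) (hT : IsSarasonToeplitz T) (f : T.domain) (hf : f ≠ 0) :
    -- the quotients `R_{f,N} = h_{f,N} / f` are defined almost everywhere
    (∀ᵐ θ ∂arc, ((f : H2) : L2) θ ≠ 0) ∧
    -- `T_{R_{f,N}} → T` strongly on `F = {f p}`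
    (∀ p : ℂ[X], ∃ (hp : polyMul p f ∈ T.domain)
      (hN : ∀ N : ℕ, polyMul p f ∈ (toeplitz (partialSubSymbol hT.shift_mem f N)).domain),
      Tendsto (fun N : ℕ => toeplitz (partialSubSymbol hT.shift_mem f N) ⟨polyMul p f, hN N⟩)
        atTop (𝓝 (T ⟨polyMul p f, hp⟩))) ∧
    -- the multiples `f_o p` of the outer factor `f_o` of `f` form a common dense domain
    (∃ fi fo : H2, IsInnerOuterFactorization f fi fo) ∧
    (∀ fi fo : H2, IsInnerOuterFactorization f fi fo →
      Dense (polyMultiples fo) ∧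
      ∀ N : ℕ, polyMultiples fo ⊆ (toeplitz (partialSubSymbol hT.shift_mem f N)).domain) := by
  have hf' : (f : H2) ≠ 0 := fun h => hf (Subtype.ext h)
  have hne := ae_ne_zero hf'
  refine ⟨hne, fun p => ⟨polyMul_mem_domain hT.shift_mem f p,
    fun N => polyMul_mem_toeplitz_domain hT.shift_mem f hne N p, ?_⟩,
    exists_isInnerOuterFactorization hf', fun fi fo h =>
      ⟨h.2.1, fun N => polyMultiples_subset_toeplitz_domain hT.shift_mem f h N⟩⟩
  exact tendsto_const_nhds.congr'
    ((eventually_toeplitz_eq hT f hne p).mono fun _ h => h.symm)
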